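/- Let $n\ge 3$. For a Riemannian $n$-manifold $M$ put $\delta_M(p)=\tau(p)-\inf K(p)$, where $\tau(p)=\sum_{i<j}K(e_i\wedge e_j)$ for an orthonormal basis $e_1,\dots,e_n$ of $T_pM$ and $\inf K(p)$ is the infimum of the sectional curvatures of the $2$-planes in $T_pM$. An isometric immersion of $M$ into a Euclidean space $\mathbb E^m$ is called ideal (more precisely, $\delta(2)$-ideal) if $\delta_M=\frac{n^2(n-2)}{2(n-1)}\,H^2$ at every point of $M$, where $H^2=|\overrightarrow H|^2$ and $\overrightarrow H=\frac1n\operatorname{trace}h$ is the mean curvature vector ($h$ being the second fundamental form). Two immersions $f_1,f_2:M\to\mathbb E^m$ are called congruent if $f_2=\Phi\circ f_1$ for some isometry $\Phi$ of $\mathbb E^m$. An isometric immersion of $M$ into $\mathbb E^m$ is called rigid if every isometric immersion of $M$ into $\mathbb E^m$ is congruent to it. All manifolds are connected and all immersions are smooth. **Proposition 5.3.** For every integer $n\ge 3$ there exist ideal hypersurfaces in $\mathbb E^{n+1}$ which are not rigid. Explicitly, let $N=\{(s,t):-\sinh^{-1}(1)<s<\sinh^{-1}(1),\ 0<t<2\pi\}$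 carry the Riemannian metric $\cosh^2 s\,(ds^2+dt^2)$, and let $N\times\mathbb E^{n-2}$ carry the product metric. Then the maps $L_1,L_2:N\times\mathbb E^{n-2}\to\mathbb E^{n+1}$, $$L_1(s,t,\mathbf x)=(\cosh s\cos t,\ \cosh s\sin t,\ s,\ \mathbf x),\qquad L_2(s,t,\mathbf x)=(\sinh s\cos t,\ \sinh s\sin t,\ t,\ \mathbf x)$$ (catenoid $\times\,\mathbb E^{n-2}$ and helicoid $\times\,\mathbb E^{n-2}$) are ideal isometric immersions of the Riemannian $n$-manifold $N\times\mathbb E^{n-2}$, they are not congruent, and neither of them is rigid. -/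

import Mathlib

open scoped ContDiff

noncomputable section

/-- The Euclidean space `𝔼ⁿ`. -/
abbrev Euc (n : ℕ) : Type := EuclideanSpace ℝ (Fin n)

/-- A symmetric 2-tensor in the standard coordinates of `ℝⁿ`: at each point the matrix
`(g_ij)` of its components. -/
abbrev MetricField (n : ℕ) : Type := Euc n → Matrix (Fin n) (Fin n) ℝ

/-- `(U, g)` is a connected Riemannian `n`-manifold covered by a single chart: `U` is a nonempty
connected open subset of `ℝⁿ` and `g` is a smooth field of positive definite symmetric matrices
on `U`. -/
structure IsRiemannianDomain {n : ℕ} (U : Set (Euc n)) (g : MetricField n) : Prop where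
  isOpen : IsOpen U
  isConnected : IsConnected U
  smooth : ∀ i j, ContDiffOn ℝ ∞ (fun x => g x i j) U
  posDef : ∀ x ∈ U, (g x).PosDef

/-- The inner product `⟨v, w⟩ = ∑ g_ij vⁱ wʲ` of tangent vectors at `p`. -/
def metricInner {n : ℕ} (g : MetricField n) (p v w : Euc n) : ℝ :=
  ∑ i, ∑ j, g p i j * v i * w j

/-- The partial derivative `∂φ/∂xⁱ` at `p`. -/
def partialDeriv {n : ℕ} (i : Fin n) (φ : Euc n → ℝ) (p : Euc n) : ℝ :=
  fderiv ℝ φ p (EuclideanSpace.single i 1)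

/-- The Christoffel symbols `Γᵏ_ij` of the Levi-Civita connection of `g`. -/
def christoffelSymbol {n : ℕ} (g : MetricField n) (k i j : Fin n) (p : Euc n) : ℝ :=
  (1 / 2) * ∑ l, (g p)⁻¹ k l *
    (partialDeriv i (fun x => g x j l) p + partialDeriv j (fun x => g x i l) p
      - partialDeriv l (fun x => g x i j) p)

/-- The `∂_l`-component of `R(∂_i, ∂_j) ∂_k = ∇_i ∇_j ∂_k - ∇_j ∇_i ∂_k`. -/
def riemannCoeff {n : ℕ} (g : MetricField n) (l k i j : Fin n) (p : Euc n) : ℝ :=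
  partialDeriv i (christoffelSymbol g l j k) p - partialDeriv j (christoffelSymbol g l i k) p
    + ∑ m, (christoffelSymbol g l i m p * christoffelSymbol g m j k p
      - christoffelSymbol g l j m p * christoffelSymbol g m i k p)

/-- The vector `R(X, Y) Z` at `p`. -/
def curvatureVec {n : ℕ} (g : MetricField n) (p X Y Z : Euc n) : Euc n :=
  WithLp.toLp 2 fun l => ∑ i, ∑ j, ∑ k, riemannCoeff g l k i j p * X i * Y j * Z k

/-- The sectional curvature `K(X ∧ Y)` of the plane spanned by linearly independent tangent
vectors `X`, `Y` at `p`. -/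
def sectionalCurv {n : ℕ} (g : MetricField n) (p X Y : Euc n) : ℝ :=
  metricInner g p (curvatureVec g p X Y Y) X /
    (metricInner g p X X * metricInner g p Y Y - metricInner g p X Y ^ 2)

/-- `inf K(p)`: the infimum of the sectional curvature over all planes in the tangent space. -/
def infSectionalCurv {n : ℕ} (g : MetricField n) (p : Euc n) : ℝ :=
  sInf {κ : ℝ | ∃ X Y : Euc n, LinearIndependent ℝ ![X, Y] ∧ κ = sectionalCurv g p X Y}

/-- `e₁, …, eₙ` is an orthonormal basis of the tangent space at `p`. -/
def IsOrthonormalFrameAt {n : ℕ} (g : MetricField n) (p : Euc n) (e : Fin n → Euc n) : Prop :=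
  ∀ i j, metricInner g p (e i) (e j) = if i = j then 1 else 0

/-- The scalar curvature `τ(p) = ∑_{i<j} K(eᵢ ∧ eⱼ)`, computed in the orthonormal basis `e`. -/
def scalarCurv {n : ℕ} (g : MetricField n) (p : Euc n) (e : Fin n → Euc n) : ℝ :=
  ∑ i, ∑ j ∈ Finset.Ioi i, sectionalCurv g p (e i) (e j)

/-- Chen's invariant `δ_M(p) = τ(p) - inf K(p)`, with `τ(p)` computed in the orthonormal
basis `e`. -/
def deltaInvariant {n : ℕ} (g : MetricField n) (p : Euc n) (e : Fin n → Euc n) : ℝ :=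
  scalarCurv g p e - infSectionalCurv g p

/-- `f` is a smooth isometric immersion of `(U, g)` into `𝔼ᵐ`. (Where `g` is positive definite,
the differential is then automatically injective.) -/
structure IsIsometricImmersion {n m : ℕ} (U : Set (Euc n)) (g : MetricField n)
    (f : Euc n → Euc m) : Prop where
  smooth : ContDiffOn ℝ ∞ f U
  isometric : ∀ p ∈ U, ∀ v w : Euc n,
    inner ℝ (fderiv ℝ f p v) (fderiv ℝ f p w) = metricInner g p v w

/-- The second fundamental form `h(v, w)`: the component of the second derivative `D²f(v, w)`
normal to the tangent space `df(T_pM)`. -/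
def secondFundForm {n m : ℕ} (f : Euc n → Euc m) (p v w : Euc n) : Euc m :=
  (LinearMap.range (fderiv ℝ f p).toLinearMap)ᗮ.starProjection
    (fderiv ℝ (fderiv ℝ f) p v w)

/-- The mean curvature vector `(1/n) trace h = (1/n) ∑ gⁱʲ h(∂ᵢ, ∂ⱼ)`. -/
def meanCurvatureVector {n m : ℕ} (g : MetricField n) (f : Euc n → Euc m) (p : Euc n) : Euc m :=
  (1 / (n : ℝ)) • ∑ i, ∑ j, (g p)⁻¹ i j •
    secondFundForm f p (EuclideanSpace.single i 1) (EuclideanSpace.single j 1)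

/-- `f` is an ideal (that is, `δ(2)`-ideal) isometric immersion of `(U, g)` into `𝔼ᵐ`: at every
point the equality `δ_M = n²(n-2)/(2(n-1)) H²` holds. -/
structure IsIdealImmersion {n m : ℕ} (U : Set (Euc n)) (g : MetricField n)
    (f : Euc n → Euc m) : Prop where
  isometricImmersion : IsIsometricImmersion U g f
  equality : ∀ p ∈ U, ∀ e : Fin n → Euc n, IsOrthonormalFrameAt g p e →
    deltaInvariant g p e =
      ((n : ℝ) ^ 2 * ((n : ℝ) - 2)) / (2 * ((n : ℝ) - 1)) * ‖meanCurvatureVector g f p‖ ^ 2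

/-- The maps `f₁` and `f₂` on `U` differ by an isometry of the ambient Euclidean space. -/
def AreCongruent {n m : ℕ} (U : Set (Euc n)) (f₁ f₂ : Euc n → Euc m) : Prop :=
  ∃ Φ : Euc m ≃ᵢ Euc m, ∀ p ∈ U, f₂ p = Φ (f₁ p)

/-- The isometric immersion `f` of `(U, g)` is rigid: it is unique up to isometries of `𝔼ᵐ`. -/
def IsRigid {n m : ℕ} (U : Set (Euc n)) (g : MetricField n) (f : Euc n → Euc m) : Prop :=
  ∀ f' : Euc n → Euc m, IsIsometricImmersion U g f' → AreCongruent U f f'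

/-- The parameter domain of `N × 𝔼ⁿ⁻²`: points `(s, t, x)` with
`-sinh⁻¹ 1 < s < sinh⁻¹ 1`, `0 < t < 2π` and `x` arbitrary. -/
def productDomain (n : ℕ) (hn : 3 ≤ n) : Set (Euc n) :=
  {p | -Real.arsinh 1 < p ⟨0, by omega⟩ ∧ p ⟨0, by omega⟩ < Real.arsinh 1 ∧
    0 < p ⟨1, by omega⟩ ∧ p ⟨1, by omega⟩ < 2 * Real.pi}

/-- The product metric `cosh² s (ds² + dt²) + |dx|²` of `N × 𝔼ⁿ⁻²`. -/
def productMetric (n : ℕ) (hn : 3 ≤ n) : MetricField n := fun p =>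
  Matrix.diagonal fun i => if i.val < 2 then Real.cosh (p ⟨0, by omega⟩) ^ 2 else 1

/-- Catenoid `× 𝔼ⁿ⁻²`: `(s, t, x) ↦ (cosh s cos t, cosh s sin t, s, x)`. -/
def catenoidProduct (n : ℕ) (hn : 3 ≤ n) (p : Euc n) : Euc (n + 1) :=
  WithLp.toLp 2 fun i : Fin (n + 1) =>
    if i.val = 0 then Real.cosh (p ⟨0, by omega⟩) * Real.cos (p ⟨1, by omega⟩)
    else if i.val = 1 then Real.cosh (p ⟨0, by omega⟩) * Real.sin (p ⟨1, by omega⟩)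
    else if i.val = 2 then p ⟨0, by omega⟩
    else p ⟨i.val - 1, by omega⟩

/-- Helicoid `× 𝔼ⁿ⁻²`: `(s, t, x) ↦ (sinh s cos t, sinh s sin t, t, x)`. -/
def helicoidProduct (n : ℕ) (hn : 3 ≤ n) (p : Euc n) : Euc (n + 1) :=
  WithLp.toLp 2 fun i : Fin (n + 1) =>
    if i.val = 0 then Real.sinh (p ⟨0, by omega⟩) * Real.cos (p ⟨1, by omega⟩)
    else if i.val = 1 then Real.sinh (p ⟨0, by omega⟩) * Real.sin (p ⟨1, by omega⟩)
    else if i.val = 2 then p ⟨1, by omega⟩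
    else p ⟨i.val - 1, by omega⟩

end

/-! The catenoid and the helicoid are isometric minimal surfaces; multiplying both by the same flat
factor keeps them isometric and minimal.

Idealness reduces to `0 = 0`. The curvature tensor of the product has a single independent
component, that of the surface, so the sectional curvature of the plane of `X`, `Y` is minus the
squared coordinate area of its projection to the surface, divided by the Gram determinant. By
`area_sq_le_gram` its minimum is the curvature `-cosh⁻⁴ s` of the surface, and by the Lagrange
identity `τ` has the same value; hence `δ = 0` (`deltaInvariant_productMetric`). On the other side
`H = 0`: the parametrizations are conformal with harmonic coordinate functions
(`meanCurvatureVector_separatedProduct`). Both immersions have coordinates of the form `u s * w t`,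
so one computation serves both.

They are not congruent because some chord of the catenoid differs in length from the corresponding
chord of the helicoid. Each is then a witness against the rigidity of the other. -/

open scoped ContDiff

noncomputable section

/-! ### The product metric and its domain -/

/-- The coefficient of `(dxⁱ)²` in the product metric. -/
def productWeight (n : ℕ) (hn : 3 ≤ n) (p : Euc n) (i : Fin n) : ℝ :=
  if i.val < 2 then Real.cosh (p ⟨0, by omega⟩) ^ 2 else 1

theorem productWeight_pos (n : ℕ) (hn : 3 ≤ n) (p : Euc n) (i : Fin n) :
    0 < productWeight n hn p i := by
  unfold productWeight
  have := Real.cosh_pos (p ⟨0, by omega⟩)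
  split_ifs <;> positivity

theorem productMetric_eq_diagonal (n : ℕ) (hn : 3 ≤ n) (p : Euc n) :
    productMetric n hn p = Matrix.diagonal (productWeight n hn p) := rfl

theorem productMetric_apply (n : ℕ) (hn : 3 ≤ n) (p : Euc n) (i j : Fin n) :
    productMetric n hn p i j = if i = j then productWeight n hn p i else 0 := by
  rw [productMetric_eq_diagonal, Matrix.diagonal_apply]

theorem productMetric_inv (n : ℕ) (hn : 3 ≤ n) (p : Euc n) :
    (productMetric n hn p)⁻¹ = Matrix.diagonal fun i => (productWeight n hn p i)⁻¹ := by
  apply Matrix.inv_eq_right_inv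
  rw [productMetric_eq_diagonal, Matrix.diagonal_mul_diagonal, ← Matrix.diagonal_one]
  congr 1
  funext i
  exact mul_inv_cancel₀ (productWeight_pos n hn p i).ne'

theorem metricInner_productMetric (n : ℕ) (hn : 3 ≤ n) (p v w : Euc n) :
    metricInner (productMetric n hn) p v w = ∑ i, productWeight n hn p i * v i * w i := by
  simp [metricInner, productMetric_apply]

/-- The inner product of the components of two vectors in the factor `𝔼ⁿ⁻²`. -/
def flatInner {n : ℕ} (v w : Euc n) : ℝ := ∑ i, if i.val < 2 then 0 else v i * w i

theorem sum_ite_lt_two (n : ℕ) (hn : 3 ≤ n) (f : Fin n → ℝ) :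
    ∑ i, (if i.val < 2 then f i else 0) = f ⟨0, by omega⟩ + f ⟨1, by omega⟩ := by
  obtain ⟨m, rfl⟩ : ∃ m, n = m + 2 := ⟨n - 2, by omega⟩
  rw [Fin.sum_univ_succ, Fin.sum_univ_succ]
  simp

theorem metricInner_productMetric_eq (n : ℕ) (hn : 3 ≤ n) (p v w : Euc n) :
    metricInner (productMetric n hn) p v w =
      Real.cosh (p ⟨0, by omega⟩) ^ 2 *
        (v ⟨0, by omega⟩ * w ⟨0, by omega⟩ + v ⟨1, by omega⟩ * w ⟨1, by omega⟩)
        + flatInner v w := by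
  rw [metricInner_productMetric, flatInner, mul_add, ← sum_ite_lt_two n hn
    (fun i => Real.cosh (p ⟨0, by omega⟩) ^ 2 * (v i * w i)), ← Finset.sum_add_distrib]
  refine Finset.sum_congr rfl fun i _ => ?_
  unfold productWeight
  split_ifs <;> ring

theorem isRiemannianDomain_product (n : ℕ) (hn : 3 ≤ n) :
    IsRiemannianDomain (productDomain n hn) (productMetric n hn) where
  isOpen := by
    refine IsOpen.and ?_ (IsOpen.and ?_ (IsOpen.and ?_ ?_)) <;>
      exact isOpen_lt (by fun_prop) (by fun_prop)
  isConnected := by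
    -- The domain is convex; the point with `t = 1` and all other coordinates `0` lies in it because
    -- `1 < 2π`.
    refine ⟨⟨EuclideanSpace.single ⟨1, by omega⟩ 1, ?_⟩, Convex.isPreconnected ?_⟩
    · have h := Real.arsinh_pos_iff.2 one_pos
      have := Real.pi_gt_three
      simp only [productDomain, Set.mem_ofPred_eq, PiLp.single_apply]
      norm_num
      linarith
    · have key : ∀ k : Fin n, IsLinearMap ℝ fun p : Euc n => (p k : ℝ) :=
        fun k => ⟨fun _ _ => rfl, fun _ _ => rfl⟩
      exact (convex_halfSpace_gt (β := ℝ) (key _) _).inter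
        ((convex_halfSpace_lt (β := ℝ) (key _) _).inter
        ((convex_halfSpace_gt (β := ℝ) (key _) _).inter (convex_halfSpace_lt (β := ℝ) (key _) _)))
  smooth i j := by
    simp only [productMetric_apply, productWeight]
    split_ifs
    · exact (Real.contDiff_cosh.comp (by fun_prop)).pow 2 |>.contDiffOn
    all_goals exact contDiffOn_const
  posDef p _ := by
    rw [productMetric_eq_diagonal, Matrix.posDef_diagonal_iff]
    exact productWeight_pos n hn p

/-! ### Christoffel symbols and the curvature tensor -/

/-- The coordinate indicator `δ_{ik}`, as a real number. -/
def coordIndicator {n : ℕ} (k i : Fin n) : ℝ := if i = k then 1 else 0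

/-- `δ_ij` for indices of the surface factor, and zero for all others. -/
def surfaceDelta {n : ℕ} (i j : Fin n) : ℝ := if i = j ∧ i.val < 2 then 1 else 0

theorem hasFDerivAt_comp_coord {n : ℕ} {u : ℝ → ℝ} {u' : ℝ} (i : Fin n) (p : Euc n)
    (hu : HasDerivAt u u' (p i)) :
    HasFDerivAt (fun q : Euc n => u (q i)) (u' • (EuclideanSpace.proj i : Euc n →L[ℝ] ℝ)) p :=
  hu.comp_hasFDerivAt p (EuclideanSpace.proj i : Euc n →L[ℝ] ℝ).hasFDerivAt

theorem partialDeriv_comp_coord {n : ℕ} {u : ℝ → ℝ} {u' : ℝ} (i k : Fin n) (p : Euc n)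
    (hu : HasDerivAt u u' (p k)) :
    partialDeriv i (fun q : Euc n => u (q k)) p = u' * coordIndicator k i := by
  rw [partialDeriv, (hasFDerivAt_comp_coord k p hu).fderiv]
  simp [coordIndicator, eq_comm]

theorem partialDeriv_productMetric (n : ℕ) (hn : 3 ≤ n) (l i j : Fin n) (p : Euc n) :
    partialDeriv l (fun x => productMetric n hn x i j) p =
      2 * Real.cosh (p ⟨0, by omega⟩) * Real.sinh (p ⟨0, by omega⟩) *
        (coordIndicator ⟨0, by omega⟩ l * surfaceDelta i j) := by
  simp only [productMetric_apply, productWeight, surfaceDelta]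
  by_cases hij : i = j
  · by_cases h2 : i.val < 2
    · simp only [if_pos hij, if_pos h2, if_pos (And.intro hij h2)]
      rw [partialDeriv_comp_coord (u := fun s => Real.cosh s ^ 2) _ _ _
        ((Real.hasDerivAt_cosh _).pow 2)]
      push_cast
      ring
    · simp [hij, hij ▸ h2, partialDeriv]
  · simp [hij, partialDeriv]

/-- The constants `Γᵏ_ij / tanh s` of the product metric. -/
def christoffelConst (n : ℕ) (hn : 3 ≤ n) (k i j : Fin n) : ℝ :=
  coordIndicator ⟨0, by omega⟩ i * surfaceDelta j k
    + coordIndicator ⟨0, by omega⟩ j * surfaceDelta i k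
    - coordIndicator ⟨0, by omega⟩ k * surfaceDelta i j

/-- The only nonzero derivative of the metric is `∂_s cosh² s = 2 cosh s sinh s`; raising an index
divides by `cosh² s` and leaves `tanh s`. For `k` in the flat factor both sides vanish. -/
theorem christoffelSymbol_productMetric (n : ℕ) (hn : 3 ≤ n) (k i j : Fin n) :
    christoffelSymbol (productMetric n hn) k i j =
      fun p => Real.tanh (p ⟨0, by omega⟩) * christoffelConst n hn k i j := by
  funext p
  have hc := (Real.cosh_pos (p ⟨0, by omega⟩)).ne'
  simp only [christoffelSymbol, partialDeriv_productMetric, productMetric_inv,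
    Matrix.diagonal_apply, christoffelConst, ite_mul, zero_mul, Finset.sum_ite_eq,
    Finset.mem_univ, if_true, productWeight]
  by_cases hk : k.val < 2
  · rw [if_pos hk, Real.tanh_eq_sinh_div_cosh]
    field_simp
  · have h1 : ∀ i : Fin n, surfaceDelta i k = 0 := fun i => by
      rw [surfaceDelta, if_neg]; rintro ⟨rfl, h⟩; exact hk h
    have h2 : coordIndicator (⟨0, by omega⟩ : Fin n) k = 0 := by
      rw [coordIndicator, if_neg]; intro h; exact hk (by simp [h])
    simp [h1, h2]

/-- The area form `X⁰ Y¹ - X¹ Y⁰` on the indices of the surface factor. -/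
def areaSign (n : ℕ) (hn : 3 ≤ n) (i j : Fin n) : ℝ :=
  coordIndicator ⟨0, by omega⟩ i * coordIndicator ⟨1, by omega⟩ j
    - coordIndicator ⟨1, by omega⟩ i * coordIndicator ⟨0, by omega⟩ j

/-- Turns index identities into polynomial identities in coordinate indicators, within reach of
`ring`. -/
theorem surfaceDelta_eq (n : ℕ) (hn : 3 ≤ n) (i j : Fin n) :
    surfaceDelta i j =
      coordIndicator ⟨0, by omega⟩ i * coordIndicator ⟨0, by omega⟩ j
        + coordIndicator ⟨1, by omega⟩ i * coordIndicator ⟨1, by omega⟩ j := by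
  simp only [surfaceDelta, coordIndicator, Fin.ext_iff]
  split_ifs <;> first | omega | norm_num

/-- The sum is an entry of a commutator `[Γ_i, Γ_j]`. The matrix `Γ_s` is the projection to the
surface directions, `Γ_t` is a quarter turn of them, and the others are zero, so all commute. -/
theorem christoffelConst_bracket (n : ℕ) (hn : 3 ≤ n) (l k i j : Fin n) :
    ∑ m, (christoffelConst n hn l i m * christoffelConst n hn m j k
      - christoffelConst n hn l j m * christoffelConst n hn m i k) = 0 := by
  have hs : ∀ m : Fin n, (christoffelConst n hn l i m * christoffelConst n hn m j k
      - christoffelConst n hn l j m * christoffelConst n hn m i k) =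
      if m.val < 2 then (christoffelConst n hn l i m * christoffelConst n hn m j k
      - christoffelConst n hn l j m * christoffelConst n hn m i k) else 0 := by
    intro m
    split_ifs with hm
    · rfl
    · have h0 : coordIndicator (⟨0, by omega⟩ : Fin n) m = 0 := by
        rw [coordIndicator, if_neg]; intro h; exact hm (by simp [h])
      have h1 : coordIndicator (⟨1, by omega⟩ : Fin n) m = 0 := by
        rw [coordIndicator, if_neg]; intro h; exact hm (by simp [h])
      simp [christoffelConst, surfaceDelta_eq n hn, h0, h1]
  rw [Finset.sum_congr rfl fun m _ => hs m, sum_ite_lt_two n hn]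
  have e00 : coordIndicator (⟨0, by omega⟩ : Fin n) ⟨0, by omega⟩ = 1 := by simp [coordIndicator]
  have e11 : coordIndicator (⟨1, by omega⟩ : Fin n) ⟨1, by omega⟩ = 1 := by simp [coordIndicator]
  have e01 : coordIndicator (⟨0, by omega⟩ : Fin n) ⟨1, by omega⟩ = 0 := by simp [coordIndicator]
  have e10 : coordIndicator (⟨1, by omega⟩ : Fin n) ⟨0, by omega⟩ = 0 := by simp [coordIndicator]
  simp only [christoffelConst, surfaceDelta_eq n hn, e00, e11, e01, e10]
  ring

/-- With the quadratic terms gone, only the derivatives of `tanh`, equal to `cosh⁻²`, contribute. -/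
theorem riemannCoeff_productMetric (n : ℕ) (hn : 3 ≤ n) (l k i j : Fin n) (p : Euc n) :
    riemannCoeff (productMetric n hn) l k i j p =
      -(Real.cosh (p ⟨0, by omega⟩) ^ 2)⁻¹ * (areaSign n hn l k * areaSign n hn i j) := by
  have hc := (Real.cosh_pos (p ⟨0, by omega⟩)).ne'
  have hT : HasDerivAt Real.tanh ((Real.cosh (p ⟨0, by omega⟩) ^ 2)⁻¹) (p ⟨0, by omega⟩) := by
    have h := (Real.hasDerivAt_sinh (p ⟨0, by omega⟩)).div (Real.hasDerivAt_cosh _) hc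
    have : Real.tanh = Real.sinh / Real.cosh := by
      funext x; exact Real.tanh_eq_sinh_div_cosh x
    rw [this]
    rwa [← sq, ← sq, Real.cosh_sq_sub_sinh_sq, one_div] at h
  simp only [riemannCoeff, christoffelSymbol_productMetric]
  rw [partialDeriv_comp_coord (u := fun s => Real.tanh s * christoffelConst n hn l j k) _ _ _
      (hT.mul_const _),
    partialDeriv_comp_coord (u := fun s => Real.tanh s * christoffelConst n hn l i k) _ _ _
      (hT.mul_const _)]
  have hsum : ∑ m, (Real.tanh (p ⟨0, by omega⟩) * christoffelConst n hn l i m *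
        (Real.tanh (p ⟨0, by omega⟩) * christoffelConst n hn m j k)
      - Real.tanh (p ⟨0, by omega⟩) * christoffelConst n hn l j m *
        (Real.tanh (p ⟨0, by omega⟩) * christoffelConst n hn m i k)) = 0 := by
    rw [← mul_zero (Real.tanh (p ⟨0, by omega⟩) ^ 2), ← christoffelConst_bracket n hn l k i j,
      Finset.mul_sum]
    exact Finset.sum_congr rfl fun m _ => by ring
  rw [hsum]
  simp only [christoffelConst, areaSign, surfaceDelta_eq n hn]
  ring

theorem sum_areaSign_mul (n : ℕ) (hn : 3 ≤ n) (X Y : Fin n → ℝ) :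
    ∑ i, ∑ j, areaSign n hn i j * X i * Y j =
      X ⟨0, by omega⟩ * Y ⟨1, by omega⟩ - X ⟨1, by omega⟩ * Y ⟨0, by omega⟩ := by
  simp [areaSign, coordIndicator, sub_mul, Finset.sum_sub_distrib]

theorem curvatureVec_productMetric (n : ℕ) (hn : 3 ≤ n) (p X Y : Euc n) (l : Fin n) :
    curvatureVec (productMetric n hn) p X Y Y l =
      -(Real.cosh (p ⟨0, by omega⟩) ^ 2)⁻¹ *
        (coordIndicator ⟨0, by omega⟩ l * Y ⟨1, by omega⟩
          - coordIndicator ⟨1, by omega⟩ l * Y ⟨0, by omega⟩) *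
        (X ⟨0, by omega⟩ * Y ⟨1, by omega⟩ - X ⟨1, by omega⟩ * Y ⟨0, by omega⟩) := by
  have hS : coordIndicator ⟨0, by omega⟩ l * Y ⟨1, by omega⟩
      - coordIndicator ⟨1, by omega⟩ l * Y ⟨0, by omega⟩ = ∑ k, areaSign n hn l k * Y k := by
    simp [areaSign, coordIndicator, sub_mul, Finset.sum_sub_distrib]
  rw [hS, ← sum_areaSign_mul n hn X Y]
  simp only [curvatureVec, riemannCoeff_productMetric]
  simp only [Finset.mul_sum, Finset.sum_mul]
  refine Finset.sum_congr rfl fun i _ => Finset.sum_congr rfl fun j _ =>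
    Finset.sum_congr rfl fun k _ => by ring

theorem metricInner_curvatureVec (n : ℕ) (hn : 3 ≤ n) (p X Y : Euc n) :
    metricInner (productMetric n hn) p (curvatureVec (productMetric n hn) p X Y Y) X =
      -(X ⟨0, by omega⟩ * Y ⟨1, by omega⟩ - X ⟨1, by omega⟩ * Y ⟨0, by omega⟩) ^ 2 := by
  have hc := (Real.cosh_pos (p ⟨0, by omega⟩)).ne'
  have hflat : flatInner (curvatureVec (productMetric n hn) p X Y Y) X = 0 := by
    refine Finset.sum_eq_zero fun i _ => ?_
    split_ifs with hi
    · rfl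
    · have h0 : coordIndicator (⟨0, by omega⟩ : Fin n) i = 0 := by
        rw [coordIndicator, if_neg]; intro h; exact hi (by simp [h])
      have h1 : coordIndicator (⟨1, by omega⟩ : Fin n) i = 0 := by
        rw [coordIndicator, if_neg]; intro h; exact hi (by simp [h])
      rw [curvatureVec_productMetric, h0, h1]
      ring
  rw [metricInner_productMetric_eq, hflat, curvatureVec_productMetric, curvatureVec_productMetric]
  simp [coordIndicator]
  field_simp
  ring

/-! ### Sectional curvature and the vanishing of `δ` -/

theorem sectionalCurv_productMetric (n : ℕ) (hn : 3 ≤ n) (p X Y : Euc n) :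
    sectionalCurv (productMetric n hn) p X Y =
      -(X ⟨0, by omega⟩ * Y ⟨1, by omega⟩ - X ⟨1, by omega⟩ * Y ⟨0, by omega⟩) ^ 2 /
        (metricInner (productMetric n hn) p X X * metricInner (productMetric n hn) p Y Y
          - metricInner (productMetric n hn) p X Y ^ 2) := by
  rw [sectionalCurv, metricInner_curvatureVec]

/-- This is the squared length of the flat part of `a Y - b X`. -/
theorem flatInner_quadratic_nonneg {n : ℕ} (X Y : Euc n) (a b : ℝ) :
    0 ≤ a ^ 2 * flatInner Y Y - 2 * a * b * flatInner X Y + b ^ 2 * flatInner X X := by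
  have : a ^ 2 * flatInner Y Y - 2 * a * b * flatInner X Y + b ^ 2 * flatInner X X =
      ∑ i, if i.val < 2 then 0 else (a * Y i - b * X i) ^ 2 := by
    simp only [flatInner, Finset.mul_sum, ← Finset.sum_sub_distrib, ← Finset.sum_add_distrib]
    refine Finset.sum_congr rfl fun i _ => ?_
    split_ifs <;> ring
  rw [this]
  refine Finset.sum_nonneg fun i _ => ?_
  split_ifs <;> positivity

theorem flatInner_sq_le {n : ℕ} (X Y : Euc n) :
    flatInner X Y ^ 2 ≤ flatInner X X * flatInner Y Y := by
  have := Finset.sum_mul_sq_le_sq_mul_sq Finset.univ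
    (fun i : Fin n => if i.val < 2 then 0 else X i) (fun i : Fin n => if i.val < 2 then 0 else Y i)
  simpa [flatInner, sq, ← ite_or] using this

/-- Expanded in powers of `cosh²`, the Gram determinant has the squared area as its leading
coefficient, by the Lagrange identity. The middle coefficient is a sum of two forms from
`flatInner_quadratic_nonneg`, one for each surface coordinate, and the last is the Cauchy–Schwarz
defect of the flat parts. -/
theorem area_sq_le_gram (n : ℕ) (hn : 3 ≤ n) (p X Y : Euc n) :
    Real.cosh (p ⟨0, by omega⟩) ^ 4 *
        (X ⟨0, by omega⟩ * Y ⟨1, by omega⟩ - X ⟨1, by omega⟩ * Y ⟨0, by omega⟩) ^ 2 ≤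
      metricInner (productMetric n hn) p X X * metricInner (productMetric n hn) p Y Y
        - metricInner (productMetric n hn) p X Y ^ 2 := by
  simp only [metricInner_productMetric_eq]
  have h0 := mul_nonneg (sq_nonneg (Real.cosh (p ⟨0, by omega⟩)))
    (flatInner_quadratic_nonneg X Y (X ⟨0, by omega⟩) (Y ⟨0, by omega⟩))
  have h1 := mul_nonneg (sq_nonneg (Real.cosh (p ⟨0, by omega⟩)))
    (flatInner_quadratic_nonneg X Y (X ⟨1, by omega⟩) (Y ⟨1, by omega⟩))
  have h2 := flatInner_sq_le X Y
  linarith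

theorem infSectionalCurv_productMetric (n : ℕ) (hn : 3 ≤ n) (p : Euc n) :
    infSectionalCurv (productMetric n hn) p = -(Real.cosh (p ⟨0, by omega⟩) ^ 4)⁻¹ := by
  have hc := Real.cosh_pos (p ⟨0, by omega⟩)
  refine IsLeast.csInf_eq ⟨?_, ?_⟩
  · refine ⟨EuclideanSpace.single ⟨0, by omega⟩ 1, EuclideanSpace.single ⟨1, by omega⟩ 1, ?_, ?_⟩
    · rw [LinearIndependent.pair_iff]
      intro a b h
      have h0 := congrArg (fun v : Euc n => v ⟨0, by omega⟩) h
      have h1 := congrArg (fun v : Euc n => v ⟨1, by omega⟩) h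
      simp at h0 h1
      exact ⟨h0, h1⟩
    · have hflat : ∀ k l : Fin n, k.val < 2 →
          flatInner (EuclideanSpace.single k 1) (EuclideanSpace.single l 1) = 0 := by
        intro k l hk
        refine Finset.sum_eq_zero fun i _ => ?_
        split_ifs with hi
        · rfl
        · have : i ≠ k := fun h => hi (h ▸ hk)
          simp [this]
      rw [sectionalCurv_productMetric]
      simp only [metricInner_productMetric_eq]
      rw [hflat _ _ (by simp), hflat _ _ (by simp), hflat _ _ (by simp)]
      simp
      field_simp
  · rintro κ ⟨X, Y, -, rfl⟩
    rw [sectionalCurv_productMetric]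
    have h := area_sq_le_gram n hn p X Y
    set a := (X ⟨0, by omega⟩ * Y ⟨1, by omega⟩ - X ⟨1, by omega⟩ * Y ⟨0, by omega⟩) ^ 2
    have ha : 0 ≤ a := sq_nonneg _
    rw [neg_div, neg_le_neg_iff]
    -- A nonnegative Gram determinant suffices here: if it is zero, the quotient is `0` by
    -- convention.
    apply div_le_of_le_mul₀ (le_trans (by positivity) h) (by positivity)
    rw [inv_mul_eq_div, le_div_iff₀ (by positivity), mul_comm]
    exact h

theorem sum_sum_Ioi_of_symm {n : ℕ} (f : Fin n → Fin n → ℝ) (hs : ∀ i j, f i j = f j i)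
    (h0 : ∀ i, f i i = 0) : 2 * ∑ i, ∑ j ∈ Finset.Ioi i, f i j = ∑ i, ∑ j, f i j := by
  have h := Finset.sum_sum_Ioi_add_eq_sum_sum_off_diag f
  rw [Finset.mul_sum]
  simp only [Finset.mul_sum]
  rw [Finset.sum_congr rfl fun i _ => Finset.sum_congr rfl fun j _ =>
    show 2 * f i j = f j i + f i j by rw [hs j i]; ring, h]
  refine Finset.sum_congr rfl fun i _ => ?_
  rw [Finset.sum_congr rfl fun j _ => hs j i, ← Finset.sum_add_sum_compl {i}]
  simp [h0]

/-- Orthonormality reads `E G Eᵀ = 1` for the matrix `E` of the frame. A right inverse of a square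
matrix is also a left inverse, so `Eᵀ E = G⁻¹`. -/
theorem sum_orthonormalFrame (n : ℕ) (hn : 3 ≤ n) (p : Euc n) (e : Fin n → Euc n)
    (he : IsOrthonormalFrameAt (productMetric n hn) p e) (i j : Fin n) :
    ∑ k, e k i * e k j = if i = j then (productWeight n hn p j)⁻¹ else 0 := by
  have h1 : (Matrix.of fun k i => e k i * productWeight n hn p i) *
      (Matrix.of fun i k => e k i) = 1 := by
    ext k l
    rw [Matrix.one_apply, ← he k l, metricInner_productMetric, Matrix.mul_apply]
    exact Finset.sum_congr rfl fun i _ => by simp [mul_comm]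
  have h3 := mul_eq_one_comm.1 h1
  have h2 := congrFun (congrFun h3 i) j
  simp only [Matrix.mul_apply, Matrix.of_apply, Matrix.one_apply, ← mul_assoc,
    ← Finset.sum_mul] at h2
  rw [eq_div_of_mul_eq (productWeight_pos n hn p j).ne' h2]
  split_ifs <;> simp

/-- In an orthonormal frame the Gram determinants are `1`, so `τ` is minus the sum of the squared `2
× 2` minors of the two surface columns. By the Lagrange identity this is a Gram determinant of those
columns, whose entries `sum_orthonormalFrame` provides. -/
theorem scalarCurv_productMetric (n : ℕ) (hn : 3 ≤ n) (p : Euc n) (e : Fin n → Euc n)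
    (he : IsOrthonormalFrameAt (productMetric n hn) p e) :
    scalarCurv (productMetric n hn) p e = -(Real.cosh (p ⟨0, by omega⟩) ^ 4)⁻¹ := by
  set f : Fin n → Fin n → ℝ := fun i j =>
    -(e i ⟨0, by omega⟩ * e j ⟨1, by omega⟩ - e i ⟨1, by omega⟩ * e j ⟨0, by omega⟩) ^ 2 with hf
  have h1 : scalarCurv (productMetric n hn) p e = ∑ i, ∑ j ∈ Finset.Ioi i, f i j := by
    refine Finset.sum_congr rfl fun i _ => Finset.sum_congr rfl fun j hj => ?_
    have hij : i ≠ j := (Finset.mem_Ioi.1 hj).ne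
    rw [sectionalCurv_productMetric, he, he, he]
    simp [hij, hf]
  have h2 := sum_sum_Ioi_of_symm f (fun i j => by simp only [hf]; ring)
    (fun i => by simp only [hf]; ring)
  have h3 : ∑ i, ∑ j, f i j =
      -2 * ((∑ i, e i ⟨0, by omega⟩ * e i ⟨0, by omega⟩) *
          (∑ j, e j ⟨1, by omega⟩ * e j ⟨1, by omega⟩)
        - (∑ i, e i ⟨0, by omega⟩ * e i ⟨1, by omega⟩) *
          (∑ j, e j ⟨0, by omega⟩ * e j ⟨1, by omega⟩)) := by
    have hsplit : ∑ i, ∑ j, f i j = -((∑ i, e i ⟨0, by omega⟩ * e i ⟨0, by omega⟩) *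
          (∑ j, e j ⟨1, by omega⟩ * e j ⟨1, by omega⟩))
        - (∑ i, e i ⟨1, by omega⟩ * e i ⟨1, by omega⟩) *
          (∑ j, e j ⟨0, by omega⟩ * e j ⟨0, by omega⟩)
        + 2 * ((∑ i, e i ⟨0, by omega⟩ * e i ⟨1, by omega⟩) *
          (∑ j, e j ⟨0, by omega⟩ * e j ⟨1, by omega⟩)) := by
      simp only [Finset.sum_mul_sum]
      simp only [Finset.mul_sum, ← Finset.sum_neg_distrib,
        ← Finset.sum_sub_distrib, ← Finset.sum_add_distrib]
      exact Finset.sum_congr rfl fun i _ => Finset.sum_congr rfl fun j _ => by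
        simp only [hf]; ring
    rw [hsplit]
    ring
  simp only [sum_orthonormalFrame n hn p e he] at h3
  simp [productWeight] at h3
  rw [h1]
  have h4 : ∀ c : ℝ, (c ^ 4)⁻¹ = (c ^ 2)⁻¹ * (c ^ 2)⁻¹ := fun c => by rw [← mul_inv]; ring_nf
  rw [h4]
  linarith

theorem deltaInvariant_productMetric (n : ℕ) (hn : 3 ≤ n) (p : Euc n) (e : Fin n → Euc n)
    (he : IsOrthonormalFrameAt (productMetric n hn) p e) :
    deltaInvariant (productMetric n hn) p e = 0 := by
  rw [deltaInvariant, scalarCurv_productMetric n hn p e he, infSectionalCurv_productMetric,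
    sub_self]

/-! ### Immersions with separated variables -/

/-- The product with `𝔼ⁿ⁻²` of the surface `(s, t) ↦ (u₀ s w₀ t, u₁ s w₁ t, u₂ s w₂ t)`. -/
def separatedProduct (n : ℕ) (hn : 3 ≤ n) (u w : ℕ → ℝ → ℝ) (p : Euc n) : Euc (n + 1) :=
  WithLp.toLp 2 fun i : Fin (n + 1) =>
    if i.val < 3 then u i.val (p ⟨0, by omega⟩) * w i.val (p ⟨1, by omega⟩)
    else p ⟨i.val - 1, by omega⟩

section
variable (n : ℕ) (hn : 3 ≤ n) {u u' u'' w w' w'' : ℕ → ℝ → ℝ}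

theorem fderiv_euclidean_apply {E : Type*} [NormedAddCommGroup E] [NormedSpace ℝ E] {m : ℕ}
    {f : E → Euc m} {p : E} (hf : DifferentiableAt ℝ f p) (v : E) (k : Fin m) :
    fderiv ℝ f p v k = fderiv ℝ (fun q => f q k) p v := by
  have := ((EuclideanSpace.proj k : Euc m →L[ℝ] ℝ).hasFDerivAt.comp p hf.hasFDerivAt).fderiv
  exact (congrArg (fun L => L v) this).symm

theorem fderiv_mul_coord {a b : ℝ → ℝ} {a' b' : ℝ} {n : ℕ} (i j : Fin n) (p v : Euc n)
    (ha : HasDerivAt a a' (p i)) (hb : HasDerivAt b b' (p j)) :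
    fderiv ℝ (fun q : Euc n => a (q i) * b (q j)) p v =
      a' * v i * b (p j) + a (p i) * (b' * v j) := by
  rw [((hasFDerivAt_comp_coord i p ha).fun_mul (hasFDerivAt_comp_coord j p hb)).fderiv]
  simp
  ring

theorem contDiff_separatedProduct (hu : ∀ k, ContDiff ℝ ∞ (u k)) (hw : ∀ k, ContDiff ℝ ∞ (w k)) :
    ContDiff ℝ ∞ (separatedProduct n hn u w) := by
  rw [contDiff_euclidean]
  intro i
  simp only [separatedProduct]
  split_ifs
  · exact ((hu _).comp (by fun_prop)).mul ((hw _).comp (by fun_prop))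
  · fun_prop

theorem fderiv_separatedProduct (hu : ∀ k, ContDiff ℝ ∞ (u k)) (hw : ∀ k, ContDiff ℝ ∞ (w k))
    (hu' : ∀ k s, HasDerivAt (u k) (u' k s) s) (hw' : ∀ k s, HasDerivAt (w k) (w' k s) s)
    (p v : Euc n) (i : Fin (n + 1)) :
    fderiv ℝ (separatedProduct n hn u w) p v i =
      if i.val < 3 then u' i.val (p ⟨0, by omega⟩) * v ⟨0, by omega⟩ * w i.val (p ⟨1, by omega⟩)
        + u i.val (p ⟨0, by omega⟩) * (w' i.val (p ⟨1, by omega⟩) * v ⟨1, by omega⟩)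
      else v ⟨i.val - 1, by omega⟩ := by
  rw [fderiv_euclidean_apply
    ((contDiff_separatedProduct n hn hu hw).differentiable (by simp)).differentiableAt]
  simp only [separatedProduct]
  split_ifs
  · exact fderiv_mul_coord _ _ p v (hu' _ _) (hw' _ _)
  · rw [show (fun q : Euc n => q ⟨i.val - 1, by omega⟩) =
      (EuclideanSpace.proj (⟨i.val - 1, by omega⟩ : Fin n) : Euc n →L[ℝ] ℝ) from rfl,
      ContinuousLinearMap.fderiv]
    rfl

/-- The coefficients `u`, `w` of a conformal parametrization: the tangent vectors `∂_s`, `∂_t` are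
orthogonal and of length `cosh s`. -/
structure IsConformalPair (u u' w w' : ℕ → ℝ → ℝ) : Prop where
  left : ∀ s t, ∑ k ∈ Finset.range 3, (u' k s * w k t) ^ 2 = Real.cosh s ^ 2
  right : ∀ s t, ∑ k ∈ Finset.range 3, (u k s * w' k t) ^ 2 = Real.cosh s ^ 2
  cross : ∀ s t, ∑ k ∈ Finset.range 3, (u' k s * w k t) * (u k s * w' k t) = 0

theorem isIsometricImmersion_separatedProduct (U : Set (Euc n))
    (hu : ∀ k, ContDiff ℝ ∞ (u k)) (hw : ∀ k, ContDiff ℝ ∞ (w k))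
    (hu' : ∀ k s, HasDerivAt (u k) (u' k s) s) (hw' : ∀ k s, HasDerivAt (w k) (w' k s) s)
    (h : IsConformalPair u u' w w') :
    IsIsometricImmersion U (productMetric n hn) (separatedProduct n hn u w) where
  smooth := (contDiff_separatedProduct n hn hu hw).contDiffOn
  isometric p _ v y := by
    obtain ⟨m, rfl⟩ : ∃ m, n = m + 2 := ⟨n - 2, by omega⟩
    rw [PiLp.inner_apply, metricInner_productMetric_eq]
    simp only [fderiv_separatedProduct _ hn hu hw hu' hw', flatInner]
    rw [Fin.sum_univ_succ, Fin.sum_univ_succ, Fin.sum_univ_succ, Fin.sum_univ_succ,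
      Fin.sum_univ_succ (n := m)]
    have h1 := h.left (p 0) (p 1)
    have h2 := h.right (p 0) (p 1)
    have h3 := h.cross (p 0) (p 1)
    simp [Finset.sum_range_succ] at h1 h2 h3
    -- The index `2 : Fin (m + 3)` has value `2 % (m + 3)`, which must be reduced before the test `<
    -- 3` can be decided.
    have hmod : 2 % (m + 2 + 1) = 2 := Nat.mod_eq_of_lt (by omega)
    have hge : ∀ i : Fin m, ¬ i.val + 1 + 1 + 1 < 3 := fun i => by omega
    simp [hmod, hge]
    have hsum : ∀ i : Fin m, (⟨i.val + 1 + 1, by omega⟩ : Fin (m + 2)) = i.succ.succ :=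
      fun i => rfl
    simp only [hsum, mul_comm (y _) (v _)]
    -- The coefficients are those of the bilinear first fundamental form `E`, `G`, `F` of the
    -- surface evaluated on `v`, `y`.
    linear_combination (v 0 * y 0) * h1 + (v 1 * y 1) * h2 + (v 0 * y 1 + v 1 * y 0) * h3

/-- Makes the Hessian the derivative of a vector-valued function, to be computed coordinate by
coordinate. -/
theorem fderiv_fderiv_separatedProduct (hu : ∀ k, ContDiff ℝ ∞ (u k)) (hw : ∀ k, ContDiff ℝ ∞ (w k))
    (p v y : Euc n) :
    fderiv ℝ (fderiv ℝ (separatedProduct n hn u w)) p v y =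
      fderiv ℝ (fun q => fderiv ℝ (separatedProduct n hn u w) q y) p v := by
  have hd : DifferentiableAt ℝ (fderiv ℝ (separatedProduct n hn u w)) p :=
    (((contDiff_separatedProduct n hn hu hw).fderiv_right (m := 1) (by
      norm_cast)).differentiable (by simp)).differentiableAt
  rw [fderiv_clm_apply hd (by fun_prop)]
  simp

/-- Diagonal entries are enough, because the inverse metric that traces the second fundamental form
is diagonal. -/
theorem hessian_separatedProduct (hu : ∀ k, ContDiff ℝ ∞ (u k)) (hw : ∀ k, ContDiff ℝ ∞ (w k))
    (hu' : ∀ k s, HasDerivAt (u k) (u' k s) s) (hw' : ∀ k s, HasDerivAt (w k) (w' k s) s)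
    (hu'' : ∀ k s, HasDerivAt (u' k) (u'' k s) s) (hw'' : ∀ k s, HasDerivAt (w' k) (w'' k s) s)
    (p : Euc n) (j : Fin n) (i : Fin (n + 1)) :
    fderiv ℝ (fderiv ℝ (separatedProduct n hn u w)) p (EuclideanSpace.single j 1)
        (EuclideanSpace.single j 1) i =
      if i.val < 3 then coordIndicator ⟨0, by omega⟩ j *
          (u'' i.val (p ⟨0, by omega⟩) * w i.val (p ⟨1, by omega⟩))
        + coordIndicator ⟨1, by omega⟩ j *
          (u i.val (p ⟨0, by omega⟩) * w'' i.val (p ⟨1, by omega⟩))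
      else 0 := by
  have hd : DifferentiableAt ℝ
      (fun q => fderiv ℝ (separatedProduct n hn u w) q (EuclideanSpace.single j 1)) p :=
    ((((contDiff_separatedProduct n hn hu hw).fderiv_right (m := 1) (by
      norm_cast)).clm_apply contDiff_const).differentiable (by simp)).differentiableAt
  rw [fderiv_fderiv_separatedProduct n hn hu hw, fderiv_euclidean_apply hd]
  simp only [fderiv_separatedProduct n hn hu hw hu' hw']
  split_ifs
  · have e1 : HasFDerivAt (fun q : Euc n => u' i.val (q ⟨0, by omega⟩) *
        (EuclideanSpace.single j 1 : Euc n) ⟨0, by omega⟩ * w i.val (q ⟨1, by omega⟩)) _ p :=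
      (((hasFDerivAt_comp_coord ⟨0, by omega⟩ p (hu'' i.val _)).mul_const
        ((EuclideanSpace.single j 1 : Euc n) ⟨0, by omega⟩)).mul
        (hasFDerivAt_comp_coord ⟨1, by omega⟩ p (hw' i.val _)))
    have e2 : HasFDerivAt (fun q : Euc n => u i.val (q ⟨0, by omega⟩) *
        (w' i.val (q ⟨1, by omega⟩) * (EuclideanSpace.single j 1 : Euc n) ⟨1, by omega⟩)) _ p :=
      ((hasFDerivAt_comp_coord ⟨0, by omega⟩ p (hu' i.val _)).mul
        ((hasFDerivAt_comp_coord ⟨1, by omega⟩ p (hw'' i.val _)).mul_const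
        ((EuclideanSpace.single j 1 : Euc n) ⟨1, by omega⟩)))
    rw [(e1.fun_add e2).fderiv]
    have hproj : ∀ (k : Fin n) (v : Euc n), (EuclideanSpace.proj k : Euc n →L[ℝ] ℝ) v = v k :=
      fun _ _ => rfl
    simp only [coordIndicator, add_apply, smul_apply, hproj, PiLp.single_apply, smul_eq_mul, eq_comm (a := j)]
    split_ifs with h0 h1
    -- The index `j` cannot be both `0` and `1`.
    · rw [← h0] at h1
      simp at h1
    all_goals ring
  · simp

/-- The two surface directions carry the same weight `cosh⁻² s` and the flat ones have zero second
derivative, so the traced Hessian is a multiple of the coordinate Laplacian, which `harm` kills. The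
normal projection is linear and is applied after the trace, so no unit normal has to be found. -/
theorem meanCurvatureVector_separatedProduct
    (hu : ∀ k, ContDiff ℝ ∞ (u k)) (hw : ∀ k, ContDiff ℝ ∞ (w k))
    (hu' : ∀ k s, HasDerivAt (u k) (u' k s) s) (hw' : ∀ k s, HasDerivAt (w k) (w' k s) s)
    (hu'' : ∀ k s, HasDerivAt (u' k) (u'' k s) s) (hw'' : ∀ k s, HasDerivAt (w' k) (w'' k s) s)
    (harm : ∀ k s t, u'' k s * w k t + u k s * w'' k t = 0) (p : Euc n) :
    meanCurvatureVector (productMetric n hn) (separatedProduct n hn u w) p = 0 := by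
  have hz : ∑ j, (productWeight n hn p j)⁻¹ •
      fderiv ℝ (fderiv ℝ (separatedProduct n hn u w)) p (EuclideanSpace.single j 1)
        (EuclideanSpace.single j 1) = 0 := by
    ext i
    simp only [WithLp.ofLp_sum, Finset.sum_apply, PiLp.smul_apply, smul_eq_mul,
      hessian_separatedProduct n hn hu hw hu' hw' hu'' hw'']
    split_ifs
    · have := harm i.val (p ⟨0, by omega⟩) (p ⟨1, by omega⟩)
      simp only [mul_add, Finset.sum_add_distrib, coordIndicator, productWeight, ite_mul, one_mul,
        zero_mul, mul_ite, mul_zero, Finset.sum_ite_eq', Finset.mem_univ, if_true]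
      norm_num [← mul_add, this]
    · simp
  simp only [meanCurvatureVector, productMetric_inv, Matrix.diagonal_apply, ite_smul, zero_smul,
    Finset.sum_ite_eq, Finset.mem_univ, if_true, secondFundForm]
  rw [Finset.sum_congr rfl fun j _ => (ContinuousLinearMap.map_smul _ _ _).symm, ← map_sum, hz,
    map_zero, smul_zero]

theorem isIdealImmersion_separatedProduct (U : Set (Euc n))
    (hu : ∀ k, ContDiff ℝ ∞ (u k)) (hw : ∀ k, ContDiff ℝ ∞ (w k))
    (hu' : ∀ k s, HasDerivAt (u k) (u' k s) s) (hw' : ∀ k s, HasDerivAt (w k) (w' k s) s)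
    (hu'' : ∀ k s, HasDerivAt (u' k) (u'' k s) s) (hw'' : ∀ k s, HasDerivAt (w' k) (w'' k s) s)
    (h : IsConformalPair u u' w w') (harm : ∀ k s t, u'' k s * w k t + u k s * w'' k t = 0) :
    IsIdealImmersion U (productMetric n hn) (separatedProduct n hn u w) where
  isometricImmersion := isIsometricImmersion_separatedProduct n hn U hu hw hu' hw' h
  equality p _ e he := by
    rw [deltaInvariant_productMetric n hn p e he,
      meanCurvatureVector_separatedProduct n hn hu hw hu' hw' hu'' hw'' harm]
    simp

end

/-! ### The catenoid and the helicoid -/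

/-- The sequence `a, b, c, c, …`. -/
def threeFunctions (a b c : ℝ → ℝ) : ℕ → ℝ → ℝ
  | 0 => a
  | 1 => b
  | _ => c

theorem contDiff_threeFunctions {a b c : ℝ → ℝ} (ha : ContDiff ℝ ∞ a) (hb : ContDiff ℝ ∞ b)
    (hc : ContDiff ℝ ∞ c) : ∀ k, ContDiff ℝ ∞ (threeFunctions a b c k)
  | 0 => ha
  | 1 => hb
  | _ + 2 => hc

theorem hasDerivAt_threeFunctions {a b c a' b' c' : ℝ → ℝ} (ha : ∀ s, HasDerivAt a (a' s) s)
    (hb : ∀ s, HasDerivAt b (b' s) s) (hc : ∀ s, HasDerivAt c (c' s) s) :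
    ∀ k s, HasDerivAt (threeFunctions a b c k) (threeFunctions a' b' c' k s) s
  | 0 => ha
  | 1 => hb
  | _ + 2 => hc

theorem catenoidProduct_eq (n : ℕ) (hn : 3 ≤ n) :
    catenoidProduct n hn = separatedProduct n hn
      (threeFunctions Real.cosh Real.cosh fun s => s)
      (threeFunctions Real.cos Real.sin fun _ => 1) := by
  funext p
  ext ⟨i, hi⟩
  rcases i with _ | _ | _ | i <;> simp [catenoidProduct, separatedProduct, threeFunctions]

theorem helicoidProduct_eq (n : ℕ) (hn : 3 ≤ n) :
    helicoidProduct n hn = separatedProduct n hn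
      (threeFunctions Real.sinh Real.sinh fun _ => 1)
      (threeFunctions Real.cos Real.sin fun t => t) := by
  funext p
  ext ⟨i, hi⟩
  rcases i with _ | _ | _ | i <;> simp [helicoidProduct, separatedProduct, threeFunctions]

theorem isIdealImmersion_catenoidProduct (n : ℕ) (hn : 3 ≤ n) (U : Set (Euc n)) :
    IsIdealImmersion U (productMetric n hn) (catenoidProduct n hn) := by
  rw [catenoidProduct_eq]
  refine isIdealImmersion_separatedProduct n hn U
    (u' := threeFunctions Real.sinh Real.sinh fun _ => 1)
    (u'' := threeFunctions Real.cosh Real.cosh fun _ => 0)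
    (w' := threeFunctions (fun t => -Real.sin t) Real.cos fun _ => 0)
    (w'' := threeFunctions (fun t => -Real.cos t) (fun t => -Real.sin t) fun _ => 0)
    (contDiff_threeFunctions Real.contDiff_cosh Real.contDiff_cosh contDiff_id)
    (contDiff_threeFunctions Real.contDiff_cos Real.contDiff_sin contDiff_const)
    (hasDerivAt_threeFunctions Real.hasDerivAt_cosh Real.hasDerivAt_cosh hasDerivAt_id)
    (hasDerivAt_threeFunctions Real.hasDerivAt_cos Real.hasDerivAt_sin
      fun _ => hasDerivAt_const _ _)
    (hasDerivAt_threeFunctions Real.hasDerivAt_sinh Real.hasDerivAt_sinh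
      fun _ => hasDerivAt_const _ _)
    (hasDerivAt_threeFunctions (fun t => (Real.hasDerivAt_sin t).neg) Real.hasDerivAt_cos
      fun _ => hasDerivAt_const _ _) ⟨?_, ?_, ?_⟩ ?_
  · intro s t
    simp only [Finset.sum_range_succ, Finset.sum_range_zero, threeFunctions]
    linear_combination Real.sinh s ^ 2 * Real.sin_sq_add_cos_sq t - Real.cosh_sq s
  · intro s t
    simp only [Finset.sum_range_succ, Finset.sum_range_zero, threeFunctions]
    linear_combination Real.cosh s ^ 2 * Real.sin_sq_add_cos_sq t
  · intro s t
    simp only [Finset.sum_range_succ, Finset.sum_range_zero, threeFunctions]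
    ring
  · rintro (_ | _ | k) s t <;> simp only [threeFunctions] <;> ring

theorem isIdealImmersion_helicoidProduct (n : ℕ) (hn : 3 ≤ n) (U : Set (Euc n)) :
    IsIdealImmersion U (productMetric n hn) (helicoidProduct n hn) := by
  rw [helicoidProduct_eq]
  refine isIdealImmersion_separatedProduct n hn U
    (u' := threeFunctions Real.cosh Real.cosh fun _ => 0)
    (u'' := threeFunctions Real.sinh Real.sinh fun _ => 0)
    (w' := threeFunctions (fun t => -Real.sin t) Real.cos fun _ => 1)
    (w'' := threeFunctions (fun t => -Real.cos t) (fun t => -Real.sin t) fun _ => 0)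
    (contDiff_threeFunctions Real.contDiff_sinh Real.contDiff_sinh contDiff_const)
    (contDiff_threeFunctions Real.contDiff_cos Real.contDiff_sin contDiff_id)
    (hasDerivAt_threeFunctions Real.hasDerivAt_sinh Real.hasDerivAt_sinh
      fun _ => hasDerivAt_const _ _)
    (hasDerivAt_threeFunctions Real.hasDerivAt_cos Real.hasDerivAt_sin hasDerivAt_id)
    (hasDerivAt_threeFunctions Real.hasDerivAt_cosh Real.hasDerivAt_cosh
      fun _ => hasDerivAt_const _ _)
    (hasDerivAt_threeFunctions (fun t => (Real.hasDerivAt_sin t).neg) Real.hasDerivAt_cos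
      fun _ => hasDerivAt_const _ _) ⟨?_, ?_, ?_⟩ ?_
  · intro s t
    simp only [Finset.sum_range_succ, Finset.sum_range_zero, threeFunctions]
    linear_combination Real.cosh s ^ 2 * Real.sin_sq_add_cos_sq t
  · intro s t
    simp only [Finset.sum_range_succ, Finset.sum_range_zero, threeFunctions]
    linear_combination Real.sinh s ^ 2 * Real.sin_sq_add_cos_sq t - Real.cosh_sq s
  · intro s t
    simp only [Finset.sum_range_succ, Finset.sum_range_zero, threeFunctions]
    ring
  · rintro (_ | _ | k) s t <;> simp only [threeFunctions] <;> ring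

/-! ### Non-congruence and non-rigidity -/

theorem AreCongruent.symm {n m : ℕ} {U : Set (Euc n)} {f₁ f₂ : Euc n → Euc m}
    (h : AreCongruent U f₁ f₂) : AreCongruent U f₂ f₁ := by
  obtain ⟨Φ, hΦ⟩ := h
  exact ⟨Φ.symm, fun p hp => by rw [hΦ p hp, IsometryEquiv.symm_apply_apply]⟩

/-- A congruence would preserve the distance of the points with parameters `(s, 1, 0)` and
`(-s, 1, 0)`, which is `2 s` on the catenoid and `2 sinh s` on the helicoid. -/
theorem not_areCongruent_catenoid_helicoid (n : ℕ) (hn : 3 ≤ n) :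
    ¬ AreCongruent (productDomain n hn) (catenoidProduct n hn) (helicoidProduct n hn) := by
  rintro ⟨Φ, hΦ⟩
  have ha : 0 < Real.arsinh 1 := Real.arsinh_pos_iff.2 one_pos
  -- Any `s` strictly between `0` and `sinh⁻¹ 1` would do.
  set s := Real.arsinh 1 / 2 with hs
  have hs0 : 0 < s := by positivity
  have hpi := Real.pi_gt_three
  let P : ℝ → Euc n := fun x =>
    WithLp.toLp 2 fun i => if i.val = 0 then x else if i.val = 1 then 1 else 0
  have hP : ∀ x, -Real.arsinh 1 < x → x < Real.arsinh 1 → P x ∈ productDomain n hn := by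
    intro x h1 h2
    simp only [productDomain, Set.mem_ofPred_eq, P]
    norm_num
    exact ⟨h1, h2, by linarith⟩
  have hd : dist (helicoidProduct n hn (P s)) (helicoidProduct n hn (P (-s))) =
      dist (catenoidProduct n hn (P s)) (catenoidProduct n hn (P (-s))) := by
    rw [hΦ _ (hP s (by linarith) (by linarith)), hΦ _ (hP (-s) (by linarith) (by linarith)),
      Φ.isometry.dist_eq]
  rw [EuclideanSpace.dist_eq, EuclideanSpace.dist_eq] at hd
  have hd2 := Real.sqrt_inj (Finset.sum_nonneg fun _ _ => sq_nonneg _)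
    (Finset.sum_nonneg fun _ _ => sq_nonneg _) |>.1 hd
  obtain ⟨m, rfl⟩ : ∃ m, n = m + 2 := ⟨n - 2, by omega⟩
  rw [Fin.sum_univ_succ, Fin.sum_univ_succ, Fin.sum_univ_succ, Fin.sum_univ_succ,
    Fin.sum_univ_succ, Fin.sum_univ_succ] at hd2
  have hmod : 2 % (m + 2 + 1) = 2 := Nat.mod_eq_of_lt (by omega)
  have htwo : (2 : Fin (m + 2 + 1)) ≠ 0 := by
    rw [Ne, Fin.ext_iff]
    exact fun h => two_ne_zero (hmod.symm.trans h)
  simp [helicoidProduct, catenoidProduct, P, Real.dist_eq, hmod, htwo] at hd2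
  clear_value s
  have hlt := Real.self_lt_sinh_iff.2 hs0
  have := Real.sin_sq_add_cos_sq 1
  -- On the helicoid only the first two coordinates differ, by `2 sinh s cos 1` and `2 sinh s sin
  -- 1`; on the catenoid only the third, by `2 s`. Equal squares contradict `0 < s < sinh s`.
  have h3 : (2 * Real.sinh s) ^ 2 = (2 * s) ^ 2 := by
    linear_combination hd2 - (2 * Real.sinh s) ^ 2 * this
  nlinarith

end

theorem proposition5p3 (n : ℕ) (hn : 3 ≤ n) :
    (∃ (U : Set (Euc n)) (g : MetricField n) (f : Euc n → Euc (n + 1)),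
      IsRiemannianDomain U g ∧ IsIdealImmersion U g f ∧ ¬ IsRigid U g f) ∧
    IsRiemannianDomain (productDomain n hn) (productMetric n hn) ∧
    IsIdealImmersion (productDomain n hn) (productMetric n hn) (catenoidProduct n hn) ∧
    IsIdealImmersion (productDomain n hn) (productMetric n hn) (helicoidProduct n hn) ∧
    ¬ AreCongruent (productDomain n hn) (catenoidProduct n hn) (helicoidProduct n hn) ∧
    ¬ IsRigid (productDomain n hn) (productMetric n hn) (catenoidProduct n hn) ∧
    ¬ IsRigid (productDomain n hn) (productMetric n hn) (helicoidProduct n hn) := by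
  have hdom := isRiemannianDomain_product n hn
  have hcat := isIdealImmersion_catenoidProduct n hn (productDomain n hn)
  have hhel := isIdealImmersion_helicoidProduct n hn (productDomain n hn)
  have hnc := not_areCongruent_catenoid_helicoid n hn
  have hr1 : ¬ IsRigid (productDomain n hn) (productMetric n hn) (catenoidProduct n hn) :=
    fun h => hnc (h _ hhel.isometricImmersion)
  have hr2 : ¬ IsRigid (productDomain n hn) (productMetric n hn) (helicoidProduct n hn) :=
    fun h => hnc (h _ hcat.isometricImmersion).symm
  exact ⟨⟨_, _, _, hdom, hcat, hr1⟩, hdom, hcat, hhel, hnc, hr1, hr2⟩
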